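/- **Lemma 3.1 (Hardy–Rellich type inequalities for a one-dimensional Schrödinger operator).** All functions are real valued, and $\|\cdot\|$ is the norm of $L^2(\mathbb R)$. Let $V$ be a bounded continuous function on $\mathbb R$ with $V\ge 0$ and $0<\int_{\mathbb R}|x|V(x)\,dx<\infty$, and let $S=-\frac{d^2}{dx^2}+V$ in $L^2(\mathbb R)$ with domain $D(S)=H^2(\mathbb R)$; let $S^{1/2}$ be its nonnegative selfadjoint square root. Let $\psi_1$ be the nondecreasing and $\psi_2$ the nonincreasing solution of $-\psi''+V\psi=0$ on $\mathbb R$ with $$\lim_{x\to-\infty}\big(\psi_1(x),x\psi_1'(x)\big)=(1,0),\qquad \lim_{x\to+\infty}\big(\psi_2(x),x\psi_2'(x)\big)=(1,0),$$ and let $k_V\equiv\psi_1'\psi_2-\psi_1\psi_2'$ be their (constant, positive) Wronskian. Then the following assertions hold. (i) $D(S^{1/2})=H^1(\mathbb R)$, and for every $f\in H^1(\mathbb R)$, $$\left\|\frac{f}{\psi_1\psi_2}\right\|\le \frac{2}{k_V}\,\|S^{1/2}f\|.$$ (ii) For every $\beta\in[0,1)$ and every $f\in H^2(\mathbb R)$,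 $$\left\|\frac{f}{(\psi_1\psi_2)^{1+\beta/2}}\right\|\le \left(\frac{4}{(1-\beta^2)k_V^2}\right)^{(2+\beta)/4}\|Sf\|^{(2+\beta)/4}\,\|f\|^{(2-\beta)/4}.$$ (iii) For every $\beta\in[0,1)$ and every $f\in H^2(\mathbb R)$, the following integral is finite and $$\int_{\mathbb R}\frac{|f'|^2+Vf^2}{(\psi_1\psi_2)^{\beta}}\,dx\le \frac{1+\beta}{1-\beta}\left(\frac{4}{(1-\beta^2)k_V^2}\right)^{\beta/2}\|Sf\|^{1+\beta/2}\,\|f\|^{1-\beta/2}.$$ -/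

import Mathlib

open MeasureTheory Filter Topology
open scoped BoundedContinuousFunction ContDiff InnerProductSpace

noncomputable section

namespace SchrodingerLine

/-- The real Hilbert space `L²(ℝ)`. -/
abbrev L2 : Type := Lp ℝ 2 (volume : Measure ℝ)

/-- The class `𝒱` of potentials: bounded continuous `V ≥ 0` on `ℝ` with
`0 < ∫ |x| V(x) dx < ∞`. -/
def potentialClass : Set (ℝ →ᵇ ℝ) :=
  {V | (∀ x, 0 ≤ V x) ∧ Integrable (fun x : ℝ => |x| * V x) ∧ 0 < ∫ x : ℝ, |x| * V x}

/-- `ψ` is a (classical) solution of `-ψ'' + Vψ = 0` on `ℝ`. -/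
def IsHarmonic (V : ℝ → ℝ) (ψ : ℝ → ℝ) : Prop :=
  ContDiff ℝ 2 ψ ∧ ∀ x, -deriv (deriv ψ) x + V x * ψ x = 0

/-- The pair `(ψ₁, ψ₂)` of solutions of `-ψ'' + Vψ = 0`, with `ψ₁` nondecreasing and normalized at
`-∞`, and `ψ₂` nonincreasing and normalized at `+∞`. For `V` in the class `𝒱` there is exactly
one such pair. -/
structure IsFundamentalPair (V : ℝ → ℝ) (ψ₁ ψ₂ : ℝ → ℝ) : Prop where
  harmonic_left : IsHarmonic V ψ₁
  harmonic_right : IsHarmonic V ψ₂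
  monotone_left : Monotone ψ₁
  antitone_right : Antitone ψ₂
  tendsto_left : Tendsto ψ₁ atBot (𝓝 1)
  tendsto_deriv_left : Tendsto (fun x => x * deriv ψ₁ x) atBot (𝓝 0)
  tendsto_right : Tendsto ψ₂ atTop (𝓝 1)
  tendsto_deriv_right : Tendsto (fun x => x * deriv ψ₂ x) atTop (𝓝 0)

/-- `g` is the weak (distributional) derivative of `f`; both functions are in `L²(ℝ)`. -/
def IsWeakDeriv (f g : L2) : Prop :=
  ∀ φ : ℝ → ℝ, ContDiff ℝ ∞ φ → HasCompactSupport φ →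
    ∫ x, f x * deriv φ x = -∫ x, g x * φ x

theorem integrable_mul_of_test (f : L2) {φ : ℝ → ℝ} (hφ : Continuous φ)
    (hc : HasCompactSupport φ) : Integrable (fun x => f x * φ x) :=
  MemLp.integrable_mul (p := 2) (q := 2) (Lp.memLp f) (hφ.memLp_of_hasCompactSupport hc)

theorem IsWeakDeriv.add {f g f' g' : L2} (h : IsWeakDeriv f g) (h' : IsWeakDeriv f' g') :
    IsWeakDeriv (f + f') (g + g') := by
  intro φ hφ hc
  have hd : Continuous (deriv φ) := hφ.continuous_deriv (by simp)
  have e1 : ∫ x, (f + f' : L2) x * deriv φ x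
      = ∫ x, (f x * deriv φ x + f' x * deriv φ x) := by
    apply integral_congr_ae
    filter_upwards [Lp.coeFn_add f f'] with x hx
    rw [hx, Pi.add_apply, add_mul]
  have e2 : ∫ x, (g + g' : L2) x * φ x = ∫ x, (g x * φ x + g' x * φ x) := by
    apply integral_congr_ae
    filter_upwards [Lp.coeFn_add g g'] with x hx
    rw [hx, Pi.add_apply, add_mul]
  rw [e1, e2, integral_add (integrable_mul_of_test f hd hc.deriv)
    (integrable_mul_of_test f' hd hc.deriv),
    integral_add (integrable_mul_of_test g hφ.continuous hc)
    (integrable_mul_of_test g' hφ.continuous hc), h φ hφ hc, h' φ hφ hc]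
  ring

theorem IsWeakDeriv.smul {f g : L2} (c : ℝ) (h : IsWeakDeriv f g) :
    IsWeakDeriv (c • f) (c • g) := by
  intro φ hφ hc
  have e1 : ∫ x, (c • f : L2) x * deriv φ x = ∫ x, c * (f x * deriv φ x) := by
    apply integral_congr_ae
    filter_upwards [Lp.coeFn_smul c f] with x hx
    rw [hx, Pi.smul_apply, smul_eq_mul, mul_assoc]
  have e2 : ∫ x, (c • g : L2) x * φ x = ∫ x, c * (g x * φ x) := by
    apply integral_congr_ae
    filter_upwards [Lp.coeFn_smul c g] with x hx
    rw [hx, Pi.smul_apply, smul_eq_mul, mul_assoc]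
  rw [e1, e2, integral_const_mul, integral_const_mul, h φ hφ hc]
  ring

theorem IsWeakDeriv.zero : IsWeakDeriv 0 0 := by
  intro φ _ _
  have e (u : ℝ → ℝ) : ∫ x, (0 : L2) x * u x = 0 := by
    rw [← integral_zero ℝ ℝ (μ := volume)]
    apply integral_congr_ae
    filter_upwards [Lp.coeFn_zero ℝ 2 (volume : Measure ℝ)] with x hx
    rw [hx, Pi.zero_apply, zero_mul]
  rw [e, e, neg_zero]

theorem IsWeakDeriv.unique {f g g' : L2} (h : IsWeakDeriv f g) (h' : IsWeakDeriv f g') :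
    g = g' := by
  apply Lp.ext
  refine ae_eq_of_integral_contDiff_smul_eq
    ((Lp.memLp g).locallyIntegrable (by norm_num))
    ((Lp.memLp g').locallyIntegrable (by norm_num)) ?_
  intro φ hφ hc
  have := neg_injective ((h φ hφ hc).symm.trans (h' φ hφ hc))
  simpa only [smul_eq_mul, mul_comm] using this

/-- The graph of the weak derivative in `L²(ℝ)`. -/
def weakDerivGraph : Submodule ℝ (L2 × L2) where
  carrier := {p | IsWeakDeriv p.1 p.2}
  add_mem' h h' := h.add h'
  zero_mem' := IsWeakDeriv.zero
  smul_mem' c _ h := h.smul c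

/-- The graph of the second weak derivative in `L²(ℝ)` (the first one being in `L²(ℝ)` too). -/
def weakDeriv2Graph : Submodule ℝ (L2 × L2) where
  carrier := {p | ∃ g : L2, IsWeakDeriv p.1 g ∧ IsWeakDeriv g p.2}
  add_mem' := by
    rintro p q ⟨g, h1, h2⟩ ⟨g', h1', h2'⟩
    exact ⟨g + g', h1.add h1', h2.add h2'⟩
  zero_mem' := ⟨0, IsWeakDeriv.zero, IsWeakDeriv.zero⟩
  smul_mem' := by
    rintro c p ⟨g, h1, h2⟩
    exact ⟨c • g, h1.smul c, h2.smul c⟩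

/-- `f ↦ f'` as an unbounded operator in `L²(ℝ)` with domain `H¹(ℝ)`. -/
def weakDeriv : L2 →ₗ.[ℝ] L2 := weakDerivGraph.toLinearPMap

/-- `f ↦ f''` as an unbounded operator in `L²(ℝ)` with domain `H²(ℝ)`. -/
def weakDeriv2 : L2 →ₗ.[ℝ] L2 := weakDeriv2Graph.toLinearPMap

/-- The Sobolev space `H¹(ℝ)`, as a subspace of `L²(ℝ)`. -/
def H1 : Submodule ℝ L2 := weakDeriv.domain

/-- The Sobolev space `H²(ℝ)`, as a subspace of `L²(ℝ)`. -/
def H2 : Submodule ℝ L2 := weakDeriv2.domain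

theorem mem_H1 {f : L2} : f ∈ H1 ↔ ∃ g : L2, IsWeakDeriv f g := by
  simp [H1, weakDeriv, weakDerivGraph, Submodule.toLinearPMap_domain]

theorem mem_H2 {f : L2} :
    f ∈ H2 ↔ ∃ g h : L2, IsWeakDeriv f g ∧ IsWeakDeriv g h := by
  simp only [H2, weakDeriv2, weakDeriv2Graph, Submodule.toLinearPMap_domain]
  simp [exists_comm (α := L2)]

theorem H2_le_H1 : H2 ≤ H1 := fun _ hf => by
  obtain ⟨g, _, h, _⟩ := mem_H2.1 hf
  exact mem_H1.2 ⟨g, h⟩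

theorem mem_graph_weakDeriv {p : L2 × L2} :
    p ∈ weakDeriv.graph ↔ IsWeakDeriv p.1 p.2 := by
  rw [weakDeriv, Submodule.toLinearPMap_graph_eq]
  · rfl
  · rintro ⟨f, g⟩ h (h0 : f = 0)
    subst h0
    exact IsWeakDeriv.unique h IsWeakDeriv.zero

theorem mem_graph_weakDeriv2 {p : L2 × L2} :
    p ∈ weakDeriv2.graph ↔ ∃ g : L2, IsWeakDeriv p.1 g ∧ IsWeakDeriv g p.2 := by
  rw [weakDeriv2, Submodule.toLinearPMap_graph_eq]
  · rfl
  · rintro ⟨f, h⟩ ⟨g, h1, h2⟩ (h0 : f = 0)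
    subst h0
    have hg : g = 0 := IsWeakDeriv.unique h1 IsWeakDeriv.zero
    subst hg
    exact IsWeakDeriv.unique h2 IsWeakDeriv.zero

theorem memLp_mul (V : ℝ →ᵇ ℝ) (f : L2) :
    MemLp (fun x => V x * f x) 2 (volume : Measure ℝ) := by
  refine MemLp.of_le_mul (c := ‖V‖) (Lp.memLp f)
    (V.continuous.aestronglyMeasurable.mul (Lp.aestronglyMeasurable f)) ?_
  filter_upwards with x
  rw [norm_mul]
  exact mul_le_mul_of_nonneg_right (V.norm_coe_le_norm x) (norm_nonneg _)

/-- Multiplication by the bounded continuous function `V` in `L²(ℝ)`. -/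
def mulOp (V : ℝ →ᵇ ℝ) : L2 →ₗ[ℝ] L2 where
  toFun f := (memLp_mul V f).toLp (fun x => V x * f x)
  map_add' f g := by
    apply Lp.ext
    filter_upwards [(memLp_mul V (f + g)).coeFn_toLp, (memLp_mul V f).coeFn_toLp,
      (memLp_mul V g).coeFn_toLp, Lp.coeFn_add f g,
      Lp.coeFn_add ((memLp_mul V f).toLp _) ((memLp_mul V g).toLp _)] with x h1 h2 h3 h4 h5
    rw [h1, h5, Pi.add_apply, h2, h3, h4, Pi.add_apply, mul_add]
  map_smul' c f := by
    apply Lp.ext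
    filter_upwards [(memLp_mul V (c • f)).coeFn_toLp, (memLp_mul V f).coeFn_toLp,
      Lp.coeFn_smul c f, Lp.coeFn_smul c ((memLp_mul V f).toLp _)] with x h1 h2 h3 h4
    rw [h1, RingHom.id_apply, h4, Pi.smul_apply, h2, h3, Pi.smul_apply, smul_eq_mul, smul_eq_mul]
    ring

/-- The Schrödinger operator `S = -d²/dx² + V` in `L²(ℝ)`, with domain `D(S) = H²(ℝ)`. -/
def schrodinger (V : ℝ →ᵇ ℝ) : L2 →ₗ.[ℝ] L2 := mulOp V +ᵥ (-weakDeriv2)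

theorem schrodinger_domain (V : ℝ →ᵇ ℝ) : (schrodinger V).domain = H2 := rfl

theorem schrodinger_apply (V : ℝ →ᵇ ℝ) (f : H2) :
    schrodinger V f = mulOp V f + -weakDeriv2 f := rfl

/-- `T` is the nonnegative selfadjoint square root `A^{1/2}` of the unbounded operator `A`:
`T` is selfadjoint and nonnegative, and `T² = A` with equality of domains, where
`D(T²) = {f ∈ D(T) ; T f ∈ D(T)}`. Every nonnegative selfadjoint `A` has exactly one. -/
structure IsNonnegSqrt {E : Type*} [NormedAddCommGroup E] [InnerProductSpace ℝ E]
    [CompleteSpace E] (A T : E →ₗ.[ℝ] E) : Prop where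
  isSelfAdjoint : IsSelfAdjoint T
  nonneg : ∀ f : T.domain, 0 ≤ ⟪T f, (f : E)⟫_ℝ
  sq_eq : ∀ f u : E, (f, u) ∈ A.graph ↔ ∃ g : E, (f, g) ∈ T.graph ∧ (g, u) ∈ T.graph

end SchrodingerLine

end

open SchrodingerLine

/-! Put w = ψ₁ψ₂ ≥ 1, a = w'/(2w) and d = k/(2w). These are the half-sum and half-difference of the
logarithmic derivatives p₁ ≥ 0 ≥ p₂ of ψ₁ and ψ₂. As pᵢ' = V - pᵢ², the Riccati equation a' = V - d²
- a² holds, with |a| ≤ d (`IsFundamentalPair.hardyWeight`).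

For f in H¹ and β ≥ 0, integrating the derivative of w^(-β) a f² gives B - K - (1+2β)D + 2Q = 0,
where B, K, D, Q are the integrals of V f², d² f², a² f², a f f' against w^(-β)
(`integral_log_identity`). With A the integral of w^(-β) f'², expanding the square of f' - c a f
gives A - 2cQ + c²D ≥ 0. For β = 0 and c = 1 this is Hardy's inequality K ≤ A + B. For f in H², the
integral I of (Sf) w^(-β) f equals A + B - 2βQ; taking c = 1 + β and using D ≤ K gives (1-β²)K ≤ I
(`rellich_form`), and then A + B ≤ (1+β)/(1-β) I (`energy_le`). Cauchy–Schwarz bounds I by ‖Sf‖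
‖w^(-β) f‖, and Hölder interpolates the last norm between ‖f/w^(1+β/2)‖ and ‖f‖; the resulting
system is solved in `interpolation_bounds`.

For (i), the energy A + B at β = 0 has to be identified with ‖S^(1/2) f‖². Both S^(1/2) and f ↦ (f',
V^(1/2) f) are closed operators whose form on D(S) is that of S, and D(S) is a core for each because
1 + S is onto; so their domains and norms agree (`IsFormGraph.exists_norm_eq`). That 1 + S is onto
is read off from S = T² with T selfadjoint. -/

namespace SchrodingerLine

/-! ### Weak derivatives on the line and integration by parts -/

theorem exists_forall_abs_ge_eq_zero {φ : ℝ → ℝ} (hc : HasCompactSupport φ) :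
    ∃ R : ℝ, 0 < R ∧ ∀ x, R ≤ |x| → φ x = 0 := by
  obtain ⟨R, hR⟩ := hc.isCompact.isBounded.exists_norm_le
  refine ⟨|R| + 1, by positivity, fun x hx => ?_⟩
  by_contra h
  have := hR x (subset_tsupport φ h)
  rw [Real.norm_eq_abs] at this
  linarith [le_abs_self R]

theorem integral_eq_intervalIntegral {φ : ℝ → ℝ} {R : ℝ} (hφ : ∀ x, R ≤ |x| → φ x = 0) {x : ℝ}
    (hx : R ≤ x) : ∫ t, φ t = ∫ t in (-R)..x, φ t := by
  refine (intervalIntegral.integral_eq_integral_of_support_subset fun t ht => ?_).symm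
  have : |t| < R := by
    by_contra h
    exact ht (hφ t (not_lt.1 h))
  exact ⟨(abs_lt.1 this).1, (abs_lt.1 this).2.le.trans hx⟩

/-- A smooth compactly supported function with zero integral is the derivative of one. -/
theorem exists_primitive_of_integral_eq_zero {θ : ℝ → ℝ} (hθ : ContDiff ℝ ∞ θ)
    (hc : HasCompactSupport θ) (h0 : ∫ x, θ x = 0) :
    ∃ χ : ℝ → ℝ, ContDiff ℝ ∞ χ ∧ HasCompactSupport χ ∧ deriv χ = θ := by
  obtain ⟨R, hR, hθR⟩ := exists_forall_abs_ge_eq_zero hc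
  have hder : ∀ x, HasDerivAt (fun x => ∫ t in (-R)..x, θ t) (θ x) x := fun x =>
    hθ.continuous.integral_hasStrictDerivAt _ x |>.hasDerivAt
  have hd : deriv (fun x => ∫ t in (-R)..x, θ t) = θ := funext fun x => (hder x).deriv
  refine ⟨fun x => ∫ t in (-R)..x, θ t, ?_, ?_, hd⟩
  · rw [contDiff_infty_iff_deriv, hd]
    exact ⟨fun x => (hder x).differentiableAt, hθ⟩
  · refine HasCompactSupport.intro (isCompact_Icc (a := -R) (b := R)) fun x hx => ?_
    rcases le_total x 0 with h | h
    · have hxR : x < -R := by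
        by_contra h'
        exact hx ⟨not_lt.1 h', by linarith⟩
      rw [intervalIntegral.integral_congr (g := fun _ => 0), intervalIntegral.integral_zero]
      intro t ht
      rw [Set.uIcc_of_ge hxR.le] at ht
      exact hθR t (by rw [abs_of_nonpos (by linarith [ht.2])]; linarith [ht.2])
    · have hxR : R < x := by
        by_contra h'
        exact hx ⟨by linarith, not_lt.1 h'⟩
      rw [← integral_eq_intervalIntegral hθR hxR.le, h0]

/-- Du Bois-Reymond's lemma. Fix a bump η of integral 1; for every test function φ, the function φ -
(∫φ)η has zero integral, hence is the derivative of a test function. So w - ∫wη is orthogonal to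
every φ. -/
theorem exists_ae_eq_const_of_integral_mul_deriv_eq_zero {w : ℝ → ℝ} (hw : LocallyIntegrable w)
    (h : ∀ φ : ℝ → ℝ, ContDiff ℝ ∞ φ → HasCompactSupport φ → ∫ x, w x * deriv φ x = 0) :
    ∃ c : ℝ, ∀ᵐ x, w x = c := by
  obtain ⟨η, hη, hηc, hη1⟩ : ∃ η : ℝ → ℝ, ContDiff ℝ ∞ η ∧ HasCompactSupport η ∧ ∫ x, η x = 1 := by
    let b : ContDiffBump (0 : ℝ) := ⟨1, 2, one_pos, one_lt_two⟩
    exact ⟨b.normed volume, b.contDiff_normed, b.hasCompactSupport_normed, b.integral_normed⟩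
  refine ⟨∫ x, w x * η x, ?_⟩
  have key := ae_eq_zero_of_integral_contDiff_smul_eq_zero (μ := volume)
    (f := fun x => w x - ∫ x, w x * η x) (hw.sub (locallyIntegrable_const _)) ?_
  · filter_upwards [key] with x hx using sub_eq_zero.1 hx
  intro φ hφ hφc
  set I : ℝ := ∫ x, φ x with hI
  have iφ : Integrable φ := hφ.continuous.integrable_of_hasCompactSupport hφc
  have iη : Integrable η := hη.continuous.integrable_of_hasCompactSupport hηc
  have iwφ : Integrable fun x => w x * φ x := by
    simpa [mul_comm] using hw.integrable_smul_left_of_hasCompactSupport hφ.continuous hφc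
  have iwη : Integrable fun x => w x * η x := by
    simpa [mul_comm] using hw.integrable_smul_left_of_hasCompactSupport hη.continuous hηc
  obtain ⟨χ, hχ, hχc, hχd⟩ := exists_primitive_of_integral_eq_zero
    (θ := fun x => φ x - I * η x) (hφ.sub (contDiff_const.mul hη)) (hφc.sub hηc.mul_left) (by
      rw [integral_sub iφ (iη.const_mul I), integral_const_mul, hη1, mul_one, sub_self])
  have h1 := h χ hχ hχc
  rw [hχd] at h1
  have e1 : ∀ x, w x * (φ x - I * η x) = w x * φ x - I * (w x * η x) := fun x => by ring
  simp_rw [e1] at h1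
  rw [integral_sub iwφ (iwη.const_mul I), integral_const_mul] at h1
  have e2 : ∀ x, φ x • (w x - ∫ x, w x * η x) = w x * φ x - (∫ x, w x * η x) * φ x :=
    fun x => by rw [smul_eq_mul]; ring
  simp_rw [e2]
  rw [integral_sub iwφ (iφ.const_mul _), integral_const_mul]
  linarith

theorem L2.intervalIntegrable (g : L2) (a b : ℝ) : IntervalIntegrable g volume a b :=
  (((Lp.memLp g).locallyIntegrable (by norm_num)).integrableOn_isCompact
    isCompact_uIcc).mono_set Set.uIoc_subset_uIcc |> intervalIntegrable_iff.2

theorem absolutelyContinuousOnInterval_of_primitive (g : L2) (a b : ℝ) :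
    AbsolutelyContinuousOnInterval (fun x => ∫ t in (0 : ℝ)..x, g t) a b := by
  -- The interval is enlarged to contain the base point 0 of the primitive.
  refine ((L2.intervalIntegrable g (min (min a b) 0) (max (max a b) 0)
    ).absolutelyContinuousOnInterval_intervalIntegral (c := 0) ?_).mono ?_
  · rw [Set.mem_uIcc]
    exact Or.inl ⟨min_le_right _ _, le_max_right _ _⟩
  · rw [Set.uIcc_of_le (a := min (min a b) 0) ((min_le_right _ _).trans (le_max_right _ _))]
    exact Set.Icc_subset_Icc (min_le_left _ _) (le_max_left _ _)

/-- An element of `H¹(ℝ)` has a locally absolutely continuous representative. -/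
theorem IsWeakDeriv.exists_representative {f g : L2} (h : IsWeakDeriv f g) :
    ∃ F : ℝ → ℝ, f =ᵐ[volume] F ∧ (∀ a b, AbsolutelyContinuousOnInterval F a b) ∧
      ∀ᵐ x, HasDerivAt F (g x) x := by
  set G : ℝ → ℝ := fun x => ∫ t in (0 : ℝ)..x, g t with hG
  have hac : ∀ a b, AbsolutelyContinuousOnInterval G a b :=
    absolutelyContinuousOnInterval_of_primitive g
  have hder : ∀ᵐ x, HasDerivAt G (g x) x := by
    have hl : LocallyIntegrable g := (Lp.memLp g).locallyIntegrable (by norm_num)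
    filter_upwards [LocallyIntegrable.ae_hasDerivAt_integral hl] with x hx using hx 0
  have hGc : Continuous G := by
    rw [← continuousOn_univ]
    intro x _
    refine ((hac (x - 1) (x + 1)).continuousOn.continuousAt ?_).continuousWithinAt
    rw [Set.uIcc_of_le (by linarith)]
    exact Icc_mem_nhds (by linarith) (by linarith)
  -- The primitive G of g has weak derivative g, so f - G has weak derivative zero and is constant.
  obtain ⟨c, hc⟩ := exists_ae_eq_const_of_integral_mul_deriv_eq_zero (w := fun x => f x - G x)
    (((Lp.memLp f).locallyIntegrable (by norm_num)).sub hGc.locallyIntegrable) (by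
      intro φ hφ hφc
      have hd : Continuous (deriv φ) := hφ.continuous_deriv (by simp)
      have iG : Integrable fun x => G x * deriv φ x :=
        (hGc.mul hd).integrable_of_hasCompactSupport hφc.deriv.mul_left
      simp_rw [sub_mul]
      rw [integral_sub (integrable_mul_of_test f hd hφc.deriv) iG, h φ hφ hφc]
      obtain ⟨R, hR, hφR⟩ := exists_forall_abs_ge_eq_zero hφc
      obtain ⟨R', hR', hφR'⟩ := exists_forall_abs_ge_eq_zero hφc.deriv
      have hm : 0 < max R R' := lt_max_of_lt_left hR
      have e1 := integral_eq_intervalIntegral (R := max R R') (φ := fun x => G x * deriv φ x)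
        (fun x hx => by rw [hφR' x ((le_max_right _ _).trans hx), mul_zero]) le_rfl
      have e2 := integral_eq_intervalIntegral (R := max R R') (φ := fun x => g x * φ x)
        (fun x hx => by rw [hφR x ((le_max_left _ _).trans hx), mul_zero]) le_rfl
      rw [e1, e2, (hac _ _).integral_mul_deriv_eq_deriv_mul
        ((hφ.of_le (by simp)).contDiffOn.absolutelyContinuousOnInterval),
        hφR _ (by rw [abs_of_pos hm]; exact le_max_left _ _),
        hφR _ (by rw [abs_neg, abs_of_pos hm]; exact le_max_left _ _)]
      have e3 : ∫ x in (-max R R')..(max R R'), deriv G x * φ x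
          = ∫ x in (-max R R')..(max R R'), g x * φ x := by
        apply intervalIntegral.integral_congr_ae
        filter_upwards [hder] with x hx _
        rw [hx.deriv]
      rw [e3]
      ring)
  refine ⟨fun x => G x + c, ?_, fun a b => ?_, ?_⟩
  · filter_upwards [hc] with x hx
    linarith
  · exact (hac a b).add ((contDiff_const (c := c)).contDiffOn.absolutelyContinuousOnInterval)
  · filter_upwards [hder] with x hx using hx.add_const c

/-- The integral over `ℝ` of an integrable derivative of an integrable function vanishes. -/
theorem integral_eq_zero_of_ae_hasDerivAt {W w : ℝ → ℝ}
    (hW : ∀ a b, AbsolutelyContinuousOnInterval W a b) (hd : ∀ᵐ x, HasDerivAt W (w x) x)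
    (iW : Integrable W) (iw : Integrable w) : ∫ x, w x = 0 := by
  have hft : ∀ a b, ∫ x in a..b, w x = W b - W a := fun a b => by
    rw [← (hW a b).integral_deriv_eq_sub]
    apply intervalIntegral.integral_congr_ae
    filter_upwards [hd] with x hx _
    rw [hx.deriv]
  have htop : Tendsto W atTop (𝓝 (W 0 + ∫ x in Set.Ioi 0, w x)) := by
    have := (intervalIntegral_tendsto_integral_Ioi 0 iw.integrableOn tendsto_id).const_add (W 0)
    simpa [hft] using this
  have hbot : Tendsto W atBot (𝓝 (W 0 - ∫ x in Set.Iic 0, w x)) := by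
    have := (intervalIntegral_tendsto_integral_Iic 0 iw.integrableOn tendsto_id).const_sub (W 0)
    simpa [hft] using this
  -- Integrability of w gives W limits at both ends; integrability of W forces them to vanish,
  -- half-lines having infinite measure.
  have h1 := IntegrableAtFilter.eq_zero_of_tendsto (iW.integrableAtFilter atTop)
    (fun s hs => by
      obtain ⟨a, ha⟩ := mem_atTop_sets.1 hs
      exact top_unique ((Real.volume_Ici (a := a)).symm.le.trans (measure_mono ha))) htop
  have h2 := IntegrableAtFilter.eq_zero_of_tendsto (iW.integrableAtFilter atBot)
    (fun s hs => by
      obtain ⟨a, ha⟩ := mem_atBot_sets.1 hs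
      exact top_unique ((Real.volume_Iic (a := a)).symm.le.trans (measure_mono ha))) hbot
  have h3 := intervalIntegral.integral_Iic_add_Ioi (b := (0 : ℝ)) (μ := volume) iw.integrableOn
    iw.integrableOn
  linarith

theorem integrable_bdd_mul_mul {b : ℝ → ℝ} (hb : Continuous b) {C : ℝ} (hC : ∀ x, |b x| ≤ C)
    (u v : L2) : Integrable fun x => b x * (u x * v x) :=
  ((Lp.memLp u).integrable_mul (q := 2) (Lp.memLp v)).bdd_mul hb.aestronglyMeasurable
    (Eventually.of_forall hC)

/-- Integration by parts in `H¹(ℝ)` with a bounded weight. -/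
theorem IsWeakDeriv.integral_weighted_parts {u u' v v' : L2} (hu : IsWeakDeriv u u')
    (hv : IsWeakDeriv v v') {b b' : ℝ → ℝ} (hb : ∀ x, HasDerivAt b (b' x) x)
    (hb' : Continuous b') {C C' : ℝ} (hC : ∀ x, |b x| ≤ C) (hC' : ∀ x, |b' x| ≤ C') :
    (∫ x, b' x * (u x * v x)) + (∫ x, b x * (u' x * v x)) + ∫ x, b x * (u x * v' x) = 0 := by
  obtain ⟨U, hU, hUac, hUd⟩ := hu.exists_representative
  obtain ⟨W, hW, hWac, hWd⟩ := hv.exists_representative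
  have hbc : Continuous b := continuous_iff_continuousAt.2 fun x => (hb x).continuousAt
  have hb1 : ContDiff ℝ 1 b := by
    rw [contDiff_one_iff_deriv]
    exact ⟨fun x => (hb x).differentiableAt, by rwa [show deriv b = b' from funext fun x =>
      (hb x).deriv]⟩
  have i1 := integrable_bdd_mul_mul hb' hC' u v
  have i2 := integrable_bdd_mul_mul hbc hC u' v
  have i3 := integrable_bdd_mul_mul hbc hC u v'
  have i0 := integrable_bdd_mul_mul hbc hC u v
  have e := integral_add (i1.add i2) i3
  simp only [Pi.add_apply] at e
  rw [← integral_add i1 i2, ← e]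
  -- Boundedness of b and b' makes both b·U·W and its derivative integrable, so no cutoff is needed.
  refine integral_eq_zero_of_ae_hasDerivAt (W := fun x => b x * (U x * W x))
    (fun a c => hb1.contDiffOn.absolutelyContinuousOnInterval.fun_mul
      ((hUac a c).fun_mul (hWac a c))) ?_ ?_ ((i1.add i2).add i3)
  · filter_upwards [hU, hW, hUd, hWd] with x h1 h2 h3 h4
    convert! (hb x).mul (h3.mul h4) using 1
    simp only [h1, h2, Pi.mul_apply]
    ring
  · refine i0.congr ?_
    filter_upwards [hU, hW] with x h1 h2
    rw [h1, h2]

/-! ### Closed operators representing the same quadratic form -/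

section Form

variable {E F F' : Type*} [NormedAddCommGroup E] [InnerProductSpace ℝ E]
  [NormedAddCommGroup F] [InnerProductSpace ℝ F]
  [NormedAddCommGroup F'] [InnerProductSpace ℝ F']

/-- `G` is the graph of a closed operator `Q` such that `D(A) ⊆ D(Q)` and
`⟪Q h, Q v⟫ = ⟪A h, v⟫` for `h ∈ D(A)` and `v ∈ D(Q)`. -/
structure IsFormGraph (A : E →ₗ.[ℝ] E) (G : Submodule ℝ (WithLp 2 (E × F))) : Prop where
  isClosed : IsClosed (G : Set (WithLp 2 (E × F)))
  snd_eq_zero : ∀ w : F, WithLp.toLp 2 (0, w) ∈ G → w = 0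
  exists_form : ∀ h u : E, (h, u) ∈ A.graph →
    ∃ w : F, WithLp.toLp 2 (h, w) ∈ G ∧ ∀ z ∈ G, ⟪w, z.snd⟫_ℝ = ⟪u, z.fst⟫_ℝ

variable {A : E →ₗ.[ℝ] E} {G : Submodule ℝ (WithLp 2 (E × F))}
  {G' : Submodule ℝ (WithLp 2 (E × F'))}

theorem IsFormGraph.eq_of_fst_eq (hG : IsFormGraph A G) {y z : WithLp 2 (E × F)} (hy : y ∈ G)
    (hz : z ∈ G) (h : y.fst = z.fst) : y = z := by
  have h1 : y - z = WithLp.toLp 2 (0, (y - z).snd) := by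
    apply WithLp.ofLp_injective
    ext
    · simp [h]
    · rfl
  have h2 := G.sub_mem hy hz
  rw [h1] at h2
  have h3 := hG.snd_eq_zero _ h2
  rw [← sub_eq_zero, h1, h3]
  rfl

/-- The restriction of the graph `G` to `D(A)`. -/
def coreGraph (A : E →ₗ.[ℝ] E) (G : Submodule ℝ (WithLp 2 (E × F))) :
    Submodule ℝ (WithLp 2 (E × F)) where
  carrier := {y | y ∈ G ∧ y.fst ∈ A.domain}
  add_mem' h h' := ⟨G.add_mem h.1 h'.1, A.domain.add_mem h.2 h'.2⟩
  zero_mem' := ⟨G.zero_mem, A.domain.zero_mem⟩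
  smul_mem' c _ h := ⟨G.smul_mem c h.1, A.domain.smul_mem c h.2⟩

theorem IsFormGraph.inner_snd (hG : IsFormGraph A G) {y z : WithLp 2 (E × F)} (hy : y ∈ G)
    (hyA : y.fst ∈ A.domain) (hz : z ∈ G) : ⟪y.snd, z.snd⟫_ℝ = ⟪A ⟨y.fst, hyA⟩, z.fst⟫_ℝ := by
  obtain ⟨w, hw, hwz⟩ := hG.exists_form _ _ (A.mem_graph ⟨y.fst, hyA⟩)
  rw [← hwz z hz, show y.snd = w from congrArg (fun a => a.snd) (hG.eq_of_fst_eq hy hw rfl)]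

/-- D(A) is a core: an element q of G orthogonal to the part of G over D(A) satisfies ⟪h + A h,
q.fst⟫ = 0 for all h in D(A). Since 1 + A is onto, q.fst = 0, and then q = 0. -/
theorem IsFormGraph.le_topologicalClosure_coreGraph [CompleteSpace E] [CompleteSpace F]
    (hG : IsFormGraph A G) (hA : ∀ e : E, ∃ h : A.domain, (h : E) + A h = e) :
    G ≤ (coreGraph A G).topologicalClosure := by
  intro x hx
  set K := (coreGraph A G).topologicalClosure with hK
  have hKG : K ≤ G := Submodule.topologicalClosure_minimal _ (fun _ h => h.1) hG.isClosed
  have : CompleteSpace K := (Submodule.isClosed_topologicalClosure _).completeSpace_coe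
  obtain ⟨p, hp, q, hq, hpq⟩ := K.exists_add_mem_mem_orthogonal x
  have hqG : q ∈ G := by
    rw [show q = x - p by rw [hpq]; abel]
    exact G.sub_mem hx (hKG hp)
  obtain ⟨h, hh⟩ := hA q.fst
  obtain ⟨w, hw, hwz⟩ := hG.exists_form _ _ (A.mem_graph h)
  have h1 := (Submodule.mem_orthogonal _ _).1 hq (WithLp.toLp 2 ((h : E), w))
    (Submodule.le_topologicalClosure _ ⟨hw, h.2⟩)
  rw [WithLp.prod_inner_apply] at h1
  have h2 : ⟪q.fst, q.fst⟫_ℝ = 0 := by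
    nth_rewrite 1 [← hh]
    rw [inner_add_left, ← hwz q hqG]
    exact h1
  have h3 : q = 0 := hG.eq_of_fst_eq hqG G.zero_mem (inner_self_eq_zero.1 h2)
  rw [hpq, h3, add_zero]
  exact hp

/-- Two closed operators representing the form of the same operator have the same domain
and norms. -/
theorem IsFormGraph.exists_norm_eq [CompleteSpace E] [CompleteSpace F] [CompleteSpace F']
    (hG : IsFormGraph A G) (hG' : IsFormGraph A G')
    (hA : ∀ e : E, ∃ h : A.domain, (h : E) + A h = e) {x : WithLp 2 (E × F)} (hx : x ∈ G) :
    ∃ x' ∈ G', x'.fst = x.fst ∧ ‖x'.snd‖ = ‖x.snd‖ := by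
  obtain ⟨y, hy, hyx⟩ := mem_closure_iff_seq_limit.1 (hG.le_topologicalClosure_coreGraph hA hx)
  have hex : ∀ n, ∃ z ∈ G', z.fst = (y n).fst := fun n => by
    obtain ⟨w, hw, -⟩ := hG'.exists_form _ _ (A.mem_graph ⟨(y n).fst, (hy n).2⟩)
    exact ⟨_, hw, rfl⟩
  choose z hz hzy using hex
  have hzc : ∀ n, z n ∈ coreGraph A G' := fun n => ⟨hz n, by rw [hzy]; exact (hy n).2⟩
  -- Over D(A) both squared norms equal ⟪A h, h⟫. An approximating sequence in one graph therefore
  -- lifts to a Cauchy sequence in the other, over the same elements of D(A).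
  have hns : ∀ a ∈ coreGraph A G, ∀ b ∈ coreGraph A G', b.fst = a.fst → ‖b.snd‖ = ‖a.snd‖ := by
    intro a ha b hb hab
    have h1 := hG.inner_snd ha.1 ha.2 ha.1
    have h2 := hG'.inner_snd hb.1 hb.2 hb.1
    simp only [hab] at h2
    rw [← h1, real_inner_self_eq_norm_sq, real_inner_self_eq_norm_sq] at h2
    exact (pow_left_inj₀ (norm_nonneg _) (norm_nonneg _) two_ne_zero).1 h2
  have hnorm : ∀ n m, ‖z n - z m‖ = ‖y n - y m‖ := fun n m => by
    have hf : (z n - z m).fst = (y n - y m).fst := by simp [hzy]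
    have hs := hns _ (Submodule.sub_mem _ (hy n) (hy m)) _ (Submodule.sub_mem _ (hzc n) (hzc m)) hf
    rw [← pow_left_inj₀ (norm_nonneg _) (norm_nonneg _) two_ne_zero, WithLp.prod_norm_sq_eq_of_L2,
      WithLp.prod_norm_sq_eq_of_L2, hf, hs]
  have hcau : CauchySeq z := by
    have := hyx.cauchySeq
    rw [Metric.cauchySeq_iff] at this ⊢
    simpa only [dist_eq_norm, hnorm] using this
  obtain ⟨x', hx'⟩ := cauchySeq_tendsto_of_complete hcau
  have cy : Continuous (fun a : WithLp 2 (E × F) => a.fst) := by fun_prop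
  have cz : Continuous (fun a : WithLp 2 (E × F') => a.fst) := by fun_prop
  refine ⟨x', hG'.isClosed.mem_of_tendsto hx' (Eventually.of_forall hz), ?_, ?_⟩
  · refine tendsto_nhds_unique ((cz.tendsto x').comp hx') ?_
    refine ((cy.tendsto x).comp hyx).congr fun n => (hzy n).symm
  · have c1 : Continuous (fun a : WithLp 2 (E × F') => ‖a.snd‖) := by fun_prop
    have c2 : Continuous (fun a : WithLp 2 (E × F) => ‖a.snd‖) := by fun_prop
    refine tendsto_nhds_unique ((c1.tendsto x').comp hx') ?_
    refine ((c2.tendsto x).comp hyx).congr fun n => (hns _ (hy n) _ (hzc n) (hzy n)).symm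

/-- The graph of `T` in the Hilbert space `E ⊕ E`. -/
def graphLp (T : E →ₗ.[ℝ] E) : Submodule ℝ (WithLp 2 (E × E)) :=
  T.graph.comap (WithLp.linearEquiv 2 ℝ (E × E)).toLinearMap

theorem mem_graphLp {T : E →ₗ.[ℝ] E} {z : WithLp 2 (E × E)} : z ∈ graphLp T ↔ (z.fst, z.snd) ∈ T.graph := Iff.rfl

end Form

/-! ### Consequences of A = T² with T selfadjoint -/

section Sqrt

variable {E : Type*} [NormedAddCommGroup E] [InnerProductSpace ℝ E] [CompleteSpace E]
  {A T : E →ₗ.[ℝ] E}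

/-- T is its own adjoint, and these relations cut out the graph of the adjoint. -/
theorem mem_graph_iff_of_isSelfAdjoint (hT : IsSelfAdjoint T) (p : E × E) :
    p ∈ T.graph ↔ ∀ q ∈ T.graph, ⟪q.2, p.1⟫_ℝ = ⟪q.1, p.2⟫_ℝ := by
  have h := LinearPMap.adjoint_graph_eq_graph_adjoint hT.dense_domain
  rw [LinearPMap.isSelfAdjoint_def.1 hT] at h
  conv_lhs => rw [h]
  simp only [Submodule.mem_adjoint_iff, sub_eq_zero, Prod.forall]

theorem isClosed_graphLp (hT : IsSelfAdjoint T) :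
    IsClosed (graphLp T : Set (WithLp 2 (E × E))) :=
  IsClosed.preimage (WithLp.prod_continuous_ofLp 2 E E) hT.isClosed

theorem IsNonnegSqrt.isFormGraph (h : IsNonnegSqrt A T) : IsFormGraph A (graphLp T) where
  isClosed := isClosed_graphLp h.isSelfAdjoint
  snd_eq_zero w hw := T.graph_fst_eq_zero_snd (mem_graphLp.1 hw) rfl
  exists_form f u hfu := by
    obtain ⟨g, hfg, hgu⟩ := (h.sq_eq f u).1 hfu
    exact ⟨g, hfg, fun z hz =>
      (((mem_graph_iff_of_isSelfAdjoint h.isSelfAdjoint _).1 hz) _ hgu).symm⟩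

/-- Von Neumann's argument: split (e, 0) as p + q along the graph of T and its orthogonal
complement. Orthogonality of q means that T maps q.snd to -q.fst; since p.snd = -q.snd, T² maps
p.fst to q.fst = e - p.fst. -/
theorem IsNonnegSqrt.exists_add_eq (h : IsNonnegSqrt A T) (e : E) :
    ∃ f : A.domain, (f : E) + A f = e := by
  have : CompleteSpace (graphLp T) := (isClosed_graphLp h.isSelfAdjoint).completeSpace_coe
  obtain ⟨p, hp, q, hq, hpq⟩ := (graphLp T).exists_add_mem_mem_orthogonal (WithLp.toLp 2 (e, 0))
  have h1 : (q.snd, -q.fst) ∈ T.graph := by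
    rw [mem_graph_iff_of_isSelfAdjoint h.isSelfAdjoint]
    intro r hr
    have := (Submodule.mem_orthogonal _ _).1 hq (WithLp.toLp 2 r) hr
    rw [WithLp.prod_inner_apply] at this
    simp only [inner_neg_right]
    exact eq_neg_of_add_eq_zero_right this
  have e1 : p.fst + q.fst = e := (congrArg (fun z => z.fst) hpq).symm
  have e2 : p.snd + q.snd = 0 := (congrArg (fun z => z.snd) hpq).symm
  have h2 : (p.snd, q.fst) ∈ T.graph := by
    have := T.graph.neg_mem h1
    rw [eq_neg_of_add_eq_zero_left e2]
    simpa using this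
  have h3 := (h.sq_eq p.fst q.fst).2 ⟨_, hp, h2⟩
  obtain ⟨y, hy1, hy2⟩ := (LinearPMap.mem_graph_iff _).1 h3
  exact ⟨y, by rw [hy1, hy2]; exact e1⟩

end Sqrt

/-! ### The quadratic form of the Schrödinger operator on H¹ -/

theorem L2.inner_eq_integral (f g : L2) : ⟪f, g⟫_ℝ = ∫ x, f x * g x := by
  rw [MeasureTheory.L2.inner_def]
  exact integral_congr_ae (Eventually.of_forall fun x => by simp [mul_comm])

theorem L2.norm_sq_eq_integral (f : L2) : ‖f‖ ^ 2 = ∫ x, f x ^ 2 := by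
  rw [← real_inner_self_eq_norm_sq, L2.inner_eq_integral]
  simp_rw [sq]

theorem mulOp_ae (V : ℝ →ᵇ ℝ) (f : L2) : mulOp V f =ᵐ[volume] fun x => V x * f x :=
  (memLp_mul V f).coeFn_toLp

theorem continuous_mulOp (V : ℝ →ᵇ ℝ) : Continuous (mulOp V) := by
  refine AddMonoidHomClass.continuous_of_bound (mulOp V) ‖V‖ fun f => ?_
  refine Lp.norm_le_mul_norm_of_ae_le_mul ?_
  filter_upwards [mulOp_ae V f] with x hx
  rw [hx, norm_mul]
  exact mul_le_mul_of_nonneg_right (V.norm_coe_le_norm x) (norm_nonneg _)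

theorem continuous_integral_mul_test {φ : ℝ → ℝ} (hφ : Continuous φ) (hc : HasCompactSupport φ) :
    Continuous fun f : L2 => ∫ x, f x * φ x := by
  have h : (fun f : L2 => ∫ x, f x * φ x)
      = fun f : L2 => ⟪f, (hφ.memLp_of_hasCompactSupport hc : MemLp φ 2 volume).toLp φ⟫_ℝ := by
    funext f
    rw [L2.inner_eq_integral]
    apply integral_congr_ae
    filter_upwards [(hφ.memLp_of_hasCompactSupport hc : MemLp φ 2 volume).coeFn_toLp] with x hx
    rw [hx]
  rw [h]
  fun_prop

/-- Each test function imposes an equality between two continuous functionals. -/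
theorem isClosed_isWeakDeriv : IsClosed {p : L2 × L2 | IsWeakDeriv p.1 p.2} := by
  simp only [IsWeakDeriv, Set.ofPred_forall]
  refine isClosed_iInter fun φ => isClosed_iInter fun hφ => isClosed_iInter fun hc => ?_
  exact isClosed_eq
    ((continuous_integral_mul_test (hφ.continuous_deriv (by simp)) hc.deriv).comp continuous_fst)
    ((continuous_integral_mul_test hφ.continuous hc).comp continuous_snd).neg

/-- The square root of a bounded continuous function. -/
noncomputable def sqrtBCF (V : ℝ →ᵇ ℝ) : ℝ →ᵇ ℝ :=
  BoundedContinuousFunction.ofNormedAddCommGroup (fun x => √(V x)) V.continuous.sqrt √‖V‖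
    fun x => by
      rw [Real.norm_of_nonneg (Real.sqrt_nonneg _)]
      exact Real.sqrt_le_sqrt ((le_abs_self _).trans (V.norm_coe_le_norm x))

theorem sqrtBCF_apply (V : ℝ →ᵇ ℝ) (x : ℝ) : sqrtBCF V x = √(V x) := rfl

theorem inner_mulOp_sqrtBCF {V : ℝ →ᵇ ℝ} (hV : ∀ x, 0 ≤ V x) (f g : L2) :
    ⟪mulOp (sqrtBCF V) f, mulOp (sqrtBCF V) g⟫_ℝ = ⟪mulOp V f, g⟫_ℝ := by
  rw [L2.inner_eq_integral, L2.inner_eq_integral]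
  apply integral_congr_ae
  filter_upwards [mulOp_ae (sqrtBCF V) f, mulOp_ae (sqrtBCF V) g, mulOp_ae V f] with x h1 h2 h3
  rw [h1, h2, h3, sqrtBCF_apply]
  nth_rewrite 3 [← Real.mul_self_sqrt (hV x)]
  ring

/-- The graph of `f ↦ (f', V^{1/2} f)` with domain `H¹(ℝ)`. -/
def energyGraph (V : ℝ →ᵇ ℝ) : Submodule ℝ (WithLp 2 (L2 × WithLp 2 (L2 × L2))) where
  carrier := {z | IsWeakDeriv z.fst z.snd.fst ∧ z.snd.snd = mulOp (sqrtBCF V) z.fst}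
  add_mem' {y z} hy hz := ⟨hy.1.add hz.1, by
    rw [WithLp.add_fst, map_add, ← hy.2, ← hz.2]; rfl⟩
  zero_mem' := ⟨IsWeakDeriv.zero, by rw [WithLp.zero_fst, map_zero]; rfl⟩
  smul_mem' c z hz := ⟨hz.1.smul c, by rw [WithLp.smul_fst, map_smul, ← hz.2]; rfl⟩

theorem schrodinger_eq_of_isWeakDeriv (V : ℝ →ᵇ ℝ) (f : H2) {g h : L2}
    (hg : IsWeakDeriv (f : L2) g) (hh : IsWeakDeriv g h) :
    schrodinger V f = mulOp V f - h := by
  have h1 : ((f : L2), h) ∈ weakDeriv2.graph := mem_graph_weakDeriv2.2 ⟨g, hg, hh⟩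
  obtain ⟨y, hy1, hy2⟩ := (LinearPMap.mem_graph_iff _).1 h1
  have h2 : weakDeriv2 f = h := (congrArg weakDeriv2 (Subtype.ext hy1 : y = f)).symm.trans hy2
  rw [sub_eq_add_neg, ← h2]
  exact schrodinger_apply V f

theorem weakDeriv_eq_of_isWeakDeriv (f : weakDeriv.domain) {g : L2}
    (hg : IsWeakDeriv (f : L2) g) : weakDeriv f = g := by
  have h1 : ((f : L2), g) ∈ weakDeriv.graph := mem_graph_weakDeriv.2 hg
  obtain ⟨y, hy1, hy2⟩ := (LinearPMap.mem_graph_iff _).1 h1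
  have h2 : y = f := Subtype.ext hy1
  subst h2
  exact hy2

/-- Integration by parts in `H¹(ℝ)`. -/
theorem IsWeakDeriv.inner_parts {u u' v v' : L2} (hu : IsWeakDeriv u u')
    (hv : IsWeakDeriv v v') : ⟪u', v⟫_ℝ = -⟪u, v'⟫_ℝ := by
  have h := hu.integral_weighted_parts hv (b := fun _ => 1) (b' := fun _ => 0) (C := 1) (C' := 0)
    (fun x => hasDerivAt_const x 1) continuous_const (fun _ => by simp) (fun _ => by simp)
  simp only [zero_mul, integral_zero, zero_add, one_mul] at h
  rw [L2.inner_eq_integral, L2.inner_eq_integral]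
  linarith

/-- The form identity is ⟪-f'', v⟫ = ⟪f', v'⟫, by parts, together with ⟪V f, v⟫ = ⟪V^(1/2) f,
V^(1/2) v⟫. -/
theorem isFormGraph_energyGraph {V : ℝ →ᵇ ℝ} (hV : ∀ x, 0 ≤ V x) :
    IsFormGraph (schrodinger V) (energyGraph V) where
  isClosed := by
    have c1 : Continuous fun z : WithLp 2 (L2 × WithLp 2 (L2 × L2)) => (z.fst, z.snd.fst) := by
      fun_prop
    have c2 : Continuous fun z : WithLp 2 (L2 × WithLp 2 (L2 × L2)) => z.snd.snd := by fun_prop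
    have c3 : Continuous fun z : WithLp 2 (L2 × WithLp 2 (L2 × L2)) => z.fst := by fun_prop
    exact (isClosed_isWeakDeriv.preimage c1).inter
      (isClosed_eq c2 ((continuous_mulOp (sqrtBCF V)).comp c3))
  snd_eq_zero w hw := by
    have h1 : w.fst = 0 := IsWeakDeriv.unique hw.1 IsWeakDeriv.zero
    have h2 : w.snd = 0 := hw.2.trans (map_zero _)
    apply WithLp.ofLp_injective
    ext1
    exacts [h1, h2]
  exists_form f u hfu := by
    obtain ⟨y, hy1, hy2⟩ := (LinearPMap.mem_graph_iff _).1 hfu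
    obtain ⟨g, h, hg, hh⟩ := mem_H2.1 (show (y : L2) ∈ H2 from y.2)
    have hy : (y : L2) = f := hy1
    subst hy
    have hu : u = mulOp V y - h := hy2.symm.trans (schrodinger_eq_of_isWeakDeriv V y hg hh)
    refine ⟨WithLp.toLp 2 (g, mulOp (sqrtBCF V) y), ⟨hg, rfl⟩, fun z hz => ?_⟩
    rw [WithLp.prod_inner_apply, hu, inner_sub_left, hh.inner_parts hz.1,
      ← inner_mulOp_sqrtBCF hV, ← hz.2]
    change ⟪g, z.snd.fst⟫_ℝ + ⟪mulOp (sqrtBCF V) y, z.snd.snd⟫_ℝ = _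
    ring

/-- The form domain of `S` is `H¹(ℝ)`. -/
theorem IsNonnegSqrt.domain_eq_H1 {V : ℝ →ᵇ ℝ} (hV : ∀ x, 0 ≤ V x) {T : L2 →ₗ.[ℝ] L2}
    (hT : IsNonnegSqrt (schrodinger V) T) : T.domain = H1 := by
  have hE := isFormGraph_energyGraph hV
  ext f
  constructor
  · intro hf
    obtain ⟨z, hz, hzf, -⟩ := hT.isFormGraph.exists_norm_eq hE hT.exists_add_eq
      (x := WithLp.toLp 2 (f, T ⟨f, hf⟩)) (T.mem_graph ⟨f, hf⟩)
    refine mem_H1.2 ⟨z.snd.fst, ?_⟩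
    have := hz.1
    rwa [hzf] at this
  · intro hf
    obtain ⟨g, hg⟩ := mem_H1.1 hf
    obtain ⟨z, hz, hzf, -⟩ := hE.exists_norm_eq hT.isFormGraph hT.exists_add_eq
      (x := WithLp.toLp 2 (f, WithLp.toLp 2 (g, mulOp (sqrtBCF V) f))) ⟨hg, rfl⟩
    have := LinearPMap.mem_domain_of_mem_graph (mem_graphLp.1 hz)
    rwa [hzf] at this

theorem IsNonnegSqrt.norm_sq_eq {V : ℝ →ᵇ ℝ} (hV : ∀ x, 0 ≤ V x) {T : L2 →ₗ.[ℝ] L2}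
    (hT : IsNonnegSqrt (schrodinger V) T) (f : T.domain) {g : L2} (hg : IsWeakDeriv (f : L2) g) :
    ‖T f‖ ^ 2 = ‖g‖ ^ 2 + ⟪mulOp V f, f⟫_ℝ := by
  have hE := isFormGraph_energyGraph hV
  obtain ⟨z, hz, hzf, hzn⟩ := hT.isFormGraph.exists_norm_eq hE hT.exists_add_eq
      (x := WithLp.toLp 2 ((f : L2), T f)) (T.mem_graph f)
  change z.fst = f at hzf
  have h1 : z.snd.fst = g := by
    refine IsWeakDeriv.unique ?_ hg
    rw [← hzf]
    exact hz.1
  change _ = ‖T f‖ at hzn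
  rw [← hzn, WithLp.prod_norm_sq_eq_of_L2, h1, hz.2, hzf, ← inner_mulOp_sqrtBCF hV,
    real_inner_self_eq_norm_sq]

/-! ### The Hardy weight ψ₁ψ₂ and its Riccati equation -/

/-- The data behind the Hardy inequality with weight `w`: `w ≥ 1`, and `a = w' / (2w)` solves the
Riccati equation `a' + a² = V - k² / (4w²)`, with `|a| ≤ k / (2w)`. -/
structure HardyWeight (V : ℝ →ᵇ ℝ) (w a : ℝ → ℝ) (k : ℝ) : Prop where
  potential_nonneg : ∀ x, 0 ≤ V x
  pos : 0 < k
  one_le : ∀ x, 1 ≤ w x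
  hasDerivAt : ∀ x, HasDerivAt w (2 * a x * w x) x
  hasDerivAt_log : ∀ x, HasDerivAt a (V x - (k / (2 * w x)) ^ 2 - a x ^ 2) x
  abs_le : ∀ x, |a x| ≤ k / (2 * w x)

theorem IsHarmonic.hasDerivAt {V ψ : ℝ → ℝ} (h : IsHarmonic V ψ) (x : ℝ) :
    HasDerivAt ψ (deriv ψ x) x :=
  (h.1.differentiable (by norm_num) x).hasDerivAt

theorem IsHarmonic.hasDerivAt_deriv {V ψ : ℝ → ℝ} (h : IsHarmonic V ψ) (x : ℝ) :
    HasDerivAt (deriv ψ) (V x * ψ x) x := by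
  have h1 : Differentiable ℝ (deriv ψ) :=
    ((contDiff_succ_iff_deriv (n := 1)).1 h.1).2.2.differentiable (by norm_num)
  have h2 := (h1 x).hasDerivAt
  rwa [show deriv (deriv ψ) x = V x * ψ x by linarith [h.2 x]] at h2

theorem IsFundamentalPair.one_le_left {V ψ₁ ψ₂ : ℝ → ℝ} (h : IsFundamentalPair V ψ₁ ψ₂) (x : ℝ) :
    1 ≤ ψ₁ x :=
  h.monotone_left.le_of_tendsto h.tendsto_left x

theorem IsFundamentalPair.one_le_right {V ψ₁ ψ₂ : ℝ → ℝ} (h : IsFundamentalPair V ψ₁ ψ₂) (x : ℝ) :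
    1 ≤ ψ₂ x :=
  h.antitone_right.le_of_tendsto h.tendsto_right x

/-- Both terms of the Wronskian are nonnegative, so k ≤ 0 would force ψ₁' = 0, hence Vψ₁ = 0 with ψ₁
≥ 1, hence V = 0, against 0 < ∫|x|V. -/
theorem IsFundamentalPair.wronskian_pos {V : ℝ →ᵇ ℝ} (hV : V ∈ potentialClass) {ψ₁ ψ₂ : ℝ → ℝ}
    (h : IsFundamentalPair V ψ₁ ψ₂) {k : ℝ}
    (hk : ∀ x, deriv ψ₁ x * ψ₂ x - ψ₁ x * deriv ψ₂ x = k) : 0 < k := by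
  by_contra hneg
  have h0 : deriv ψ₁ = fun _ => 0 := by
    funext x
    have h1 : 0 ≤ deriv ψ₁ x := h.monotone_left.deriv_nonneg
    have h2 : deriv ψ₂ x ≤ 0 := h.antitone_right.deriv_nonpos
    have h3 := h.one_le_left x
    have h4 := h.one_le_right x
    nlinarith [hk x]
  have hV0 : ∀ x, V x = 0 := fun x => by
    have h1 := (h.harmonic_left.hasDerivAt_deriv x).deriv
    rw [h0, deriv_const] at h1
    have h3 := h.one_le_left x
    exact (mul_eq_zero.1 h1.symm).resolve_right (by linarith)
  have := hV.2.2
  simp [hV0] at this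

theorem IsFundamentalPair.hardyWeight {V : ℝ →ᵇ ℝ} (hV : V ∈ potentialClass) {ψ₁ ψ₂ : ℝ → ℝ}
    (h : IsFundamentalPair V ψ₁ ψ₂) {k : ℝ}
    (hk : ∀ x, deriv ψ₁ x * ψ₂ x - ψ₁ x * deriv ψ₂ x = k) :
    HardyWeight V (fun x => ψ₁ x * ψ₂ x)
      (fun x => (deriv ψ₁ x / ψ₁ x + deriv ψ₂ x / ψ₂ x) / 2) k where
  potential_nonneg := hV.1
  pos := h.wronskian_pos hV hk
  one_le x := one_le_mul_of_one_le_of_one_le (h.one_le_left x) (h.one_le_right x)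
  hasDerivAt x := by
    have h3 := h.one_le_left x
    have h4 := h.one_le_right x
    have h5 : ψ₁ x ≠ 0 := by positivity
    have h6 : ψ₂ x ≠ 0 := by positivity
    convert! (h.harmonic_left.hasDerivAt x).mul (h.harmonic_right.hasDerivAt x) using 1
    field_simp
  hasDerivAt_log x := by
    have h3 := h.one_le_left x
    have h4 := h.one_le_right x
    have h5 : ψ₁ x ≠ 0 := by positivity
    have h6 : ψ₂ x ≠ 0 := by positivity
    convert! (((h.harmonic_left.hasDerivAt_deriv x).div (h.harmonic_left.hasDerivAt x) h5).add
      ((h.harmonic_right.hasDerivAt_deriv x).div (h.harmonic_right.hasDerivAt x) h6)).div_const 2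
      using 1
    rw [← hk x]
    field_simp
    ring
  abs_le x := by
    have h1 : 0 ≤ deriv ψ₁ x := h.monotone_left.deriv_nonneg
    have h2 : deriv ψ₂ x ≤ 0 := h.antitone_right.deriv_nonpos
    have h3 := h.one_le_left x
    have h4 := h.one_le_right x
    have h5 : 0 ≤ deriv ψ₁ x / ψ₁ x := by positivity
    have h6 : deriv ψ₂ x / ψ₂ x ≤ 0 := div_nonpos_of_nonpos_of_nonneg h2 (by positivity)
    -- Hence |a| ≤ k/(2w): for p₁ ≥ 0 ≥ p₂ the half-sum is dominated by the half-difference.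
    have h7 : k / (2 * (ψ₁ x * ψ₂ x)) = (deriv ψ₁ x / ψ₁ x - deriv ψ₂ x / ψ₂ x) / 2 := by
      have h5 : ψ₁ x ≠ 0 := by positivity
      have h6 : ψ₂ x ≠ 0 := by positivity
      rw [← hk x]
      field_simp
    rw [h7, abs_le]
    constructor <;> linarith

/-! ### Weighted identities and the Hardy and Rellich inequalities -/

namespace HardyWeight

variable {V : ℝ →ᵇ ℝ} {w a : ℝ → ℝ} {k : ℝ} (H : HardyWeight V w a k)
include H

theorem continuous_weight : Continuous w :=
  continuous_iff_continuousAt.2 fun x => (H.hasDerivAt x).continuousAt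

theorem continuous_log : Continuous a :=
  continuous_iff_continuousAt.2 fun x => (H.hasDerivAt_log x).continuousAt

theorem weight_pos (x : ℝ) : 0 < w x := one_pos.trans_le (H.one_le x)

theorem hasDerivAt_rpow (β : ℝ) (x : ℝ) :
    HasDerivAt (fun x => w x ^ (-β)) (-(2 * β) * (w x ^ (-β) * a x)) x := by
  have h := (H.hasDerivAt x).rpow_const (p := -β) (Or.inl (H.weight_pos x).ne')
  convert! h using 1
  rw [Real.rpow_sub_one (H.weight_pos x).ne']
  have := (H.weight_pos x).ne'
  field_simp

/-- The Riccati equation contributes -a² and the factor w^(-β), with derivative -2βa w^(-β),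
contributes -2βa²; hence the coefficient 1 + 2β. -/
theorem hasDerivAt_rpow_mul (β : ℝ) (x : ℝ) :
    HasDerivAt (fun x => w x ^ (-β) * a x)
      (w x ^ (-β) * V x - w x ^ (-β) * (k / (2 * w x)) ^ 2
        - (1 + 2 * β) * (w x ^ (-β) * a x ^ 2)) x := by
  convert! (H.hasDerivAt_rpow β x).mul (H.hasDerivAt_log x) using 1
  ring

theorem continuous_rpow (β : ℝ) : Continuous fun x => w x ^ (-β) :=
  H.continuous_weight.rpow_const fun x => Or.inl (H.weight_pos x).ne'

theorem continuous_quot : Continuous fun x => k / (2 * w x) :=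
  continuous_const.div (continuous_const.mul H.continuous_weight) fun x =>
    (mul_pos two_pos (H.weight_pos x)).ne'

theorem rpow_pos (β : ℝ) (x : ℝ) : 0 < w x ^ (-β) := Real.rpow_pos_of_pos (H.weight_pos x) _

theorem rpow_le_one {β : ℝ} (hβ : 0 ≤ β) (x : ℝ) : w x ^ (-β) ≤ 1 :=
  Real.rpow_le_one_of_one_le_of_nonpos (H.one_le x) (by linarith)

theorem quot_nonneg (x : ℝ) : 0 ≤ k / (2 * w x) :=
  div_nonneg H.pos.le (mul_pos two_pos (H.weight_pos x)).le

theorem quot_le (x : ℝ) : k / (2 * w x) ≤ k / 2 :=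
  div_le_div_of_nonneg_left H.pos.le two_pos (by linarith [H.one_le x])

theorem sq_le_quot_sq (x : ℝ) : a x ^ 2 ≤ (k / (2 * w x)) ^ 2 :=
  sq_le_sq' (_root_.abs_le.1 (H.abs_le x)).1 (_root_.abs_le.1 (H.abs_le x)).2

/-- Since w ≥ 1 and β ≥ 0, the factor w^(-β) preserves bounds; this keeps all the weights admissible
for integration by parts. -/
theorem abs_rpow_mul_le {β : ℝ} (hβ : 0 ≤ β) {t C : ℝ} (x : ℝ) (ht : |t| ≤ C) :
    |w x ^ (-β) * t| ≤ C := by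
  rw [abs_mul, abs_of_pos (H.rpow_pos β x)]
  exact (mul_le_of_le_one_left (abs_nonneg t) (H.rpow_le_one hβ x)).trans ht

theorem abs_le_half (x : ℝ) : |a x| ≤ k / 2 := (H.abs_le x).trans (H.quot_le x)

theorem abs_quot_sq_le (x : ℝ) : |(k / (2 * w x)) ^ 2| ≤ (k / 2) ^ 2 := by
  rw [abs_of_nonneg (sq_nonneg _)]
  exact pow_le_pow_left₀ (H.quot_nonneg x) (H.quot_le x) 2

theorem abs_sq_le (x : ℝ) : |a x ^ 2| ≤ (k / 2) ^ 2 := by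
  rw [abs_of_nonneg (sq_nonneg _)]
  refine (H.sq_le_quot_sq x).trans ((le_abs_self _).trans (H.abs_quot_sq_le x))

theorem integrable_rpow_mul {β : ℝ} (hβ : 0 ≤ β) {b : ℝ → ℝ} (hb : Continuous b) {C : ℝ}
    (hC : ∀ x, |b x| ≤ C) (u v : L2) :
    Integrable fun x => w x ^ (-β) * b x * (u x * v x) :=
  integrable_bdd_mul_mul ((H.continuous_rpow β).mul hb)
    (fun x => H.abs_rpow_mul_le hβ x (hC x)) u v

theorem integrable_rpow {β : ℝ} (hβ : 0 ≤ β) (u v : L2) :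
    Integrable fun x => w x ^ (-β) * (u x * v x) :=
  integrable_bdd_mul_mul (H.continuous_rpow β) (C := 1)
    (fun x => by rw [abs_of_pos (H.rpow_pos β x)]; exact H.rpow_le_one hβ x) u v

theorem integrable_rpow_mul_quot_sq {β : ℝ} (hβ : 0 ≤ β) (u v : L2) :
    Integrable fun x => w x ^ (-β) * (k / (2 * w x)) ^ 2 * (u x * v x) :=
  H.integrable_rpow_mul hβ (H.continuous_quot.pow 2) H.abs_quot_sq_le u v

theorem integrable_rpow_mul_sq {β : ℝ} (hβ : 0 ≤ β) (u v : L2) :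
    Integrable fun x => w x ^ (-β) * a x ^ 2 * (u x * v x) :=
  H.integrable_rpow_mul hβ (H.continuous_log.pow 2) H.abs_sq_le u v

theorem integral_log_identity {β : ℝ} (hβ : 0 ≤ β) {f g : L2} (hg : IsWeakDeriv f g) :
    (∫ x, w x ^ (-β) * V x * (f x * f x)) - (∫ x, w x ^ (-β) * (k / (2 * w x)) ^ 2 * (f x * f x))
      - (1 + 2 * β) * (∫ x, w x ^ (-β) * a x ^ 2 * (f x * f x))
      + 2 * ∫ x, w x ^ (-β) * a x * (f x * g x) = 0 := by
  have i1 := H.integrable_rpow_mul hβ V.continuous V.norm_coe_le_norm f f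
  have i2 := H.integrable_rpow_mul_quot_sq hβ f f
  have i3 := H.integrable_rpow_mul_sq hβ f f
  have h := hg.integral_weighted_parts hg (H.hasDerivAt_rpow_mul β)
    ((((H.continuous_rpow β).mul V.continuous).sub
      ((H.continuous_rpow β).mul (H.continuous_quot.pow 2))).sub
      (continuous_const.mul ((H.continuous_rpow β).mul (H.continuous_log.pow 2))))
    (C := k / 2) (C' := ‖V‖ + (k / 2) ^ 2 + (1 + 2 * β) * (k / 2) ^ 2)
    (fun x => H.abs_rpow_mul_le hβ x (H.abs_le_half x)) (fun x => by
      refine (abs_sub _ _).trans (add_le_add ((abs_sub _ _).trans (add_le_add ?_ ?_)) ?_)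
      · exact H.abs_rpow_mul_le hβ x (V.norm_coe_le_norm x)
      · exact H.abs_rpow_mul_le hβ x (H.abs_quot_sq_le x)
      · rw [abs_mul, abs_of_pos (by linarith)]
        exact mul_le_mul_of_nonneg_left (H.abs_rpow_mul_le hβ x (H.abs_sq_le x)) (by linarith))
  have e1 : ∫ x, (w x ^ (-β) * V x - w x ^ (-β) * (k / (2 * w x)) ^ 2
        - (1 + 2 * β) * (w x ^ (-β) * a x ^ 2)) * (f x * f x)
      = (∫ x, w x ^ (-β) * V x * (f x * f x))
        - (∫ x, w x ^ (-β) * (k / (2 * w x)) ^ 2 * (f x * f x))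
        - (1 + 2 * β) * ∫ x, w x ^ (-β) * a x ^ 2 * (f x * f x) := by
    rw [← integral_const_mul, ← integral_sub i1 i2]
    have := integral_sub (i1.sub i2) (i3.const_mul (1 + 2 * β))
    simp only [Pi.sub_apply] at this
    rw [← this]
    exact integral_congr_ae (Eventually.of_forall fun x => by ring)
  have e2 : ∫ x, w x ^ (-β) * a x * (g x * f x) = ∫ x, w x ^ (-β) * a x * (f x * g x) :=
    integral_congr_ae (Eventually.of_forall fun x => by ring)
  rw [e1, e2] at h
  linarith

theorem integral_square_nonneg {β : ℝ} (hβ : 0 ≤ β) (c : ℝ) (f g : L2) :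
    0 ≤ (∫ x, w x ^ (-β) * (g x * g x)) - 2 * c * (∫ x, w x ^ (-β) * a x * (f x * g x))
      + c ^ 2 * ∫ x, w x ^ (-β) * a x ^ 2 * (f x * f x) := by
  have i1 := H.integrable_rpow hβ g g
  have i2 := H.integrable_rpow_mul hβ H.continuous_log H.abs_le_half f g
  have i3 := H.integrable_rpow_mul_sq hβ f f
  rw [← integral_const_mul, ← integral_const_mul, ← integral_sub i1 (i2.const_mul _)]
  have := integral_add (i1.sub (i2.const_mul (2 * c))) (i3.const_mul (c ^ 2))
  simp only [Pi.sub_apply] at this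
  rw [← this]
  refine integral_nonneg fun x => ?_
  have h := mul_nonneg (H.rpow_pos β x).le (sq_nonneg (g x - c * a x * f x))
  calc (0 : ℝ) ≤ _ := h
    _ = _ := by ring

theorem integral_sq_le_integral_quot_sq {β : ℝ} (hβ : 0 ≤ β) (f : L2) :
    ∫ x, w x ^ (-β) * a x ^ 2 * (f x * f x)
      ≤ ∫ x, w x ^ (-β) * (k / (2 * w x)) ^ 2 * (f x * f x) :=
  integral_mono (H.integrable_rpow_mul_sq hβ f f)
    (H.integrable_rpow_mul_quot_sq hβ f f) fun x =>
      mul_le_mul_of_nonneg_right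
        (mul_le_mul_of_nonneg_left (H.sq_le_quot_sq x) (H.rpow_pos β x).le) (mul_self_nonneg _)

/-- The Hardy inequality: `∫ k² f² / (4w²) ≤ ∫ f'² + V f²`. -/
theorem hardy {f g : L2} (hg : IsWeakDeriv f g) :
    ∫ x, (k / (2 * w x)) ^ 2 * (f x * f x) ≤ ‖g‖ ^ 2 + ⟪mulOp V f, f⟫_ℝ := by
  have h1 := H.integral_log_identity le_rfl hg
  have h2 := H.integral_square_nonneg le_rfl 1 f g
  have h3 : ⟪mulOp V f, f⟫_ℝ = ∫ x, V x * (f x * f x) := by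
    rw [L2.inner_eq_integral]
    apply integral_congr_ae
    filter_upwards [mulOp_ae V f] with x hx
    rw [hx, mul_assoc]
  rw [h3, ← real_inner_self_eq_norm_sq, L2.inner_eq_integral]
  simp only [neg_zero, Real.rpow_zero, one_mul] at h1 h2
  linarith

theorem integral_form_identity {β : ℝ} (hβ : 0 ≤ β) {f g h : L2} (hg : IsWeakDeriv f g)
    (hh : IsWeakDeriv g h) :
    ∫ x, (mulOp V f - h : L2) x * (w x ^ (-β) * f x)
      = (∫ x, w x ^ (-β) * (g x * g x)) + (∫ x, w x ^ (-β) * V x * (f x * f x))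
        - 2 * β * ∫ x, w x ^ (-β) * a x * (f x * g x) := by
  have i1 := H.integrable_rpow_mul hβ V.continuous V.norm_coe_le_norm f f
  have i2 := H.integrable_rpow hβ f h
  have hp := hg.integral_weighted_parts hh (H.hasDerivAt_rpow β)
    (continuous_const.mul ((H.continuous_rpow β).mul H.continuous_log))
    (C := 1) (C' := 2 * β * (k / 2))
    (fun x => by rw [abs_of_pos (H.rpow_pos β x)]; exact H.rpow_le_one hβ x) (fun x => by
      rw [abs_mul, abs_neg, abs_of_nonneg (by linarith)]
      exact mul_le_mul_of_nonneg_left (H.abs_rpow_mul_le hβ x (H.abs_le_half x)) (by linarith))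
  have e1 : ∫ x, -(2 * β) * (w x ^ (-β) * a x) * (f x * g x)
      = -(2 * β) * ∫ x, w x ^ (-β) * a x * (f x * g x) := by
    rw [← integral_const_mul]
    exact integral_congr_ae (Eventually.of_forall fun x => by ring)
  have e2 : ∫ x, (mulOp V f - h : L2) x * (w x ^ (-β) * f x)
      = (∫ x, w x ^ (-β) * V x * (f x * f x)) - ∫ x, w x ^ (-β) * (f x * h x) := by
    rw [← integral_sub i1 i2]
    apply integral_congr_ae
    filter_upwards [Lp.coeFn_sub (mulOp V f) h, mulOp_ae V f] with x h1 h2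
    rw [h1, Pi.sub_apply, h2]
    ring
  rw [e1] at hp
  rw [e2]
  linarith

theorem rellich_form {β : ℝ} (hβ : 0 ≤ β) {f g h : L2} (hg : IsWeakDeriv f g)
    (hh : IsWeakDeriv g h) :
    (1 - β ^ 2) * ∫ x, w x ^ (-β) * (k / (2 * w x)) ^ 2 * (f x * f x)
      ≤ ∫ x, (mulOp V f - h : L2) x * (w x ^ (-β) * f x) := by
  have h1 := H.integral_log_identity hβ hg
  -- With c = 1 + β the cross terms of A + B - 2βQ add up to 2Q, which the logarithmic identity
  -- turns into K + (1+2β)D - B. What remains is K - β²D, and D ≤ K.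
  have h2 := H.integral_square_nonneg hβ (1 + β) f g
  have h3 := H.integral_sq_le_integral_quot_sq hβ f
  rw [H.integral_form_identity hβ hg hh]
  nlinarith [mul_le_mul_of_nonneg_left h3 (sq_nonneg β)]

/-- Eliminating Q gives A + B = I + β(K + (1+2β)D - B) ≤ I + 2β(1+β)K, by D ≤ K and B ≥ 0. The bound
(1-β²)K ≤ I then yields the factor 1 + 2β/(1-β). -/
theorem energy_le {β : ℝ} (hβ : 0 ≤ β) (hβ1 : β < 1) {f g h : L2} (hg : IsWeakDeriv f g)
    (hh : IsWeakDeriv g h) :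
    (∫ x, w x ^ (-β) * (g x * g x)) + (∫ x, w x ^ (-β) * V x * (f x * f x))
      ≤ (1 + β) / (1 - β) * ∫ x, (mulOp V f - h : L2) x * (w x ^ (-β) * f x) := by
  have h1 := H.integral_log_identity hβ hg
  have h3 := H.integral_sq_le_integral_quot_sq hβ f
  have h4 := H.rellich_form hβ hg hh
  have h5 := H.integral_form_identity hβ hg hh
  have h6 : 0 ≤ ∫ x, w x ^ (-β) * V x * (f x * f x) := integral_nonneg fun x =>
    mul_nonneg (mul_nonneg (H.rpow_pos β x).le (H.potential_nonneg x)) (mul_self_nonneg _)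
  rw [div_mul_eq_mul_div, le_div_iff₀ (by linarith)]
  set I := ∫ x, (mulOp V f - h : L2) x * (w x ^ (-β) * f x)
  set K := ∫ x, w x ^ (-β) * (k / (2 * w x)) ^ 2 * (f x * f x)
  set D := ∫ x, w x ^ (-β) * a x ^ 2 * (f x * f x)
  set B := ∫ x, w x ^ (-β) * V x * (f x * f x)
  set A := ∫ x, w x ^ (-β) * (g x * g x)
  set Q := ∫ x, w x ^ (-β) * a x * (f x * g x)
  have h7 : A + B ≤ I + 2 * β * (1 + β) * K := by
    have e : 2 * Q = K + (1 + 2 * β) * D - B := by linarith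
    have e' : A + B = I + β * (2 * Q) := by linarith
    rw [e', e]
    have h8 := mul_le_mul_of_nonneg_left h3 (by positivity : 0 ≤ β * (1 + 2 * β))
    nlinarith [mul_nonneg hβ h6]
  have h8 := mul_le_mul_of_nonneg_left h4 (by linarith : 0 ≤ 2 * β)
  nlinarith [mul_le_mul_of_nonneg_right h7 (by linarith : 0 ≤ 1 - β)]

end HardyWeight

/-! ### Interpolation between the weighted norm and the L² norm -/

/-- Hölder's inequality with exponents 1/θ and 1/(1-θ), including the endpoint θ = 0 that occurs for
β = 0. -/
theorem integral_rpow_mul_rpow_le {p q : ℝ → ℝ} (hp : ∀ x, 0 ≤ p x) (hq : ∀ x, 0 ≤ q x)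
    (ip : Integrable p) (iq : Integrable q) {θ : ℝ} (h0 : 0 ≤ θ) (h1 : θ ≤ 1) :
    ∫ x, p x ^ θ * q x ^ (1 - θ) ≤ (∫ x, p x) ^ θ * (∫ x, q x) ^ (1 - θ) := by
  have h1' : 0 ≤ 1 - θ := by linarith
  have hm : AEMeasurable fun x => p x ^ θ * q x ^ (1 - θ) :=
    (ip.aemeasurable.pow_const θ).mul (iq.aemeasurable.pow_const (1 - θ))
  have hle := ENNReal.lintegral_mul_norm_pow_le (μ := volume) ip.aemeasurable.ennreal_ofReal
    iq.aemeasurable.ennreal_ofReal h0 h1' (by ring)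
  have e : ∀ x, ENNReal.ofReal (p x) ^ θ * ENNReal.ofReal (q x) ^ (1 - θ)
      = ENNReal.ofReal (p x ^ θ * q x ^ (1 - θ)) := fun x => by
    rw [ENNReal.ofReal_mul (Real.rpow_nonneg (hp x) _), ENNReal.ofReal_rpow_of_nonneg (hp x) h0,
      ENNReal.ofReal_rpow_of_nonneg (hq x) h1']
  simp_rw [e] at hle
  rw [integral_eq_lintegral_of_nonneg_ae (Eventually.of_forall fun x =>
      mul_nonneg (Real.rpow_nonneg (hp x) _) (Real.rpow_nonneg (hq x) _)) hm.aestronglyMeasurable,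
    integral_eq_lintegral_of_nonneg_ae (Eventually.of_forall hp) ip.aestronglyMeasurable,
    integral_eq_lintegral_of_nonneg_ae (Eventually.of_forall hq) iq.aestronglyMeasurable,
    ENNReal.toReal_rpow, ENNReal.toReal_rpow, ← ENNReal.toReal_mul]
  refine ENNReal.toReal_mono (ENNReal.mul_ne_top (ENNReal.rpow_ne_top_of_nonneg h0 ?_)
    (ENNReal.rpow_ne_top_of_nonneg h1' ?_)) hle
  · exact ip.lintegral_lt_top.ne
  · exact iq.lintegral_lt_top.ne

theorem eLpNorm_two_le_ofReal {u : ℝ → ℝ} (hu : AEStronglyMeasurable u)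
    (hi : Integrable fun x => u x ^ 2) {c : ℝ} (hc : 0 ≤ c) (h : ∫ x, u x ^ 2 ≤ c ^ 2) :
    eLpNorm u 2 volume ≤ ENNReal.ofReal c := by
  have hm : MemLp u 2 volume := (memLp_two_iff_integrable_sq hu).2 hi
  rw [hm.eLpNorm_eq_integral_rpow_norm two_ne_zero ENNReal.ofNat_ne_top]
  refine ENNReal.ofReal_le_ofReal ?_
  simp only [ENNReal.toReal_ofNat, Real.rpow_two, Real.norm_eq_abs, sq_abs]
  rw [← one_div, ← Real.sqrt_eq_rpow]
  exact Real.sqrt_le_iff.2 ⟨hc, h⟩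

/-- Used with X = ‖f/w^(1+β/2)‖, s = ‖Sf‖, n = ‖f‖. Inserting the second bound into the first leaves
X^(2 - 2β/(2+β)) = X^(4/(2+β)) on the left, whence the exponent (2+β)/4; the bound on X is then fed
back into that on I. -/
theorem interpolation_bounds {X C I s n β : ℝ} (hX : 0 ≤ X) (hC : 0 ≤ C) (hs : 0 ≤ s) (hn : 0 ≤ n)
    (hβ : 0 ≤ β) (hβ1 : β < 1) (h1 : X ^ 2 ≤ C * I)
    (h2 : I ≤ s * (X ^ (2 * β / (2 + β)) * n ^ ((2 - β) / (2 + β)))) :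
    X ≤ C ^ ((2 + β) / 4) * s ^ ((2 + β) / 4) * n ^ ((2 - β) / 4) ∧
      I ≤ C ^ (β / 2) * s ^ (1 + β / 2) * n ^ (1 - β / 2) := by
  have hβ2 : 0 < 2 + β := by linarith
  have hβ3 : 0 ≤ (2 - β) / (2 + β) := div_nonneg (by linarith) hβ2.le
  have hX1 : X ≤ C ^ ((2 + β) / 4) * s ^ ((2 + β) / 4) * n ^ ((2 - β) / 4) := by
    -- A power of X is divided out below, so X = 0 is treated apart.
    rcases hX.eq_or_lt with rfl | hX0
    · positivity
    have h3 : X ^ 2 ≤ C * s * n ^ ((2 - β) / (2 + β)) * X ^ (2 * β / (2 + β)) := by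
      refine h1.trans ((mul_le_mul_of_nonneg_left h2 hC).trans_eq (by ring))
    have h4 : X ^ (4 / (2 + β)) ≤ C * s * n ^ ((2 - β) / (2 + β)) := by
      rw [show (4 : ℝ) / (2 + β) = 2 - 2 * β / (2 + β) by field_simp; ring, Real.rpow_sub hX0,
        Real.rpow_two]
      exact (div_le_iff₀ (Real.rpow_pos_of_pos hX0 _)).2 h3
    have h5 := Real.rpow_le_rpow (by positivity) h4 (by positivity : 0 ≤ (2 + β) / 4)
    rw [← Real.rpow_mul hX, show 4 / (2 + β) * ((2 + β) / 4) = 1 by field_simp, Real.rpow_one,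
      Real.mul_rpow (by positivity) (by positivity), Real.mul_rpow hC hs, ← Real.rpow_mul hn,
      show (2 - β) / (2 + β) * ((2 + β) / 4) = (2 - β) / 4 by field_simp] at h5
    exact h5
  refine ⟨hX1, h2.trans ?_⟩
  have hθ : 0 ≤ 2 * β / (2 + β) := by positivity
  have h6 := Real.rpow_le_rpow hX hX1 hθ
  have hβ4 : 0 ≤ (2 - β) / 4 := by linarith
  rw [Real.mul_rpow (by positivity) (by positivity), Real.mul_rpow (by positivity) (by positivity),
    ← Real.rpow_mul hC, ← Real.rpow_mul hs, ← Real.rpow_mul hn,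
    show (2 + β) / 4 * (2 * β / (2 + β)) = β / 2 by field_simp; ring] at h6
  have e1 : s ^ (1 + β / 2) = s * s ^ (β / 2) := by
    rw [Real.rpow_add_of_nonneg hs zero_le_one (by positivity), Real.rpow_one]
  have e2 : n ^ (1 - β / 2) = n ^ ((2 - β) / 4 * (2 * β / (2 + β))) * n ^ ((2 - β) / (2 + β)) := by
    rw [← Real.rpow_add_of_nonneg hn (by positivity) hβ3]
    congr 1
    field_simp
    ring
  rw [e1, e2]
  calc s * (X ^ (2 * β / (2 + β)) * n ^ ((2 - β) / (2 + β)))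
      ≤ s * (C ^ (β / 2) * s ^ (β / 2) * n ^ ((2 - β) / 4 * (2 * β / (2 + β)))
          * n ^ ((2 - β) / (2 + β))) := by gcongr
    _ = _ := by ring

namespace HardyWeight

variable {V : ℝ →ᵇ ℝ} {w a : ℝ → ℝ} {k : ℝ} (H : HardyWeight V w a k)
include H

theorem memLp_rpow_mul {β : ℝ} (hβ : 0 ≤ β) (f : L2) :
    MemLp (fun x => w x ^ (-β) * f x) 2 (volume : Measure ℝ) := by
  refine MemLp.of_le_mul (c := 1) (Lp.memLp f)
    ((H.continuous_rpow β).aestronglyMeasurable.mul (Lp.aestronglyMeasurable f)) ?_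
  filter_upwards with x
  rw [norm_mul, Real.norm_of_nonneg (H.rpow_pos β x).le]
  exact mul_le_mul_of_nonneg_right (H.rpow_le_one hβ x) (norm_nonneg _)

theorem quot_sq_eq (β : ℝ) (x t : ℝ) :
    (t / w x ^ (1 + β / 2)) ^ 2
      = (2 / k) ^ 2 * (w x ^ (-β) * (k / (2 * w x)) ^ 2 * (t * t)) := by
  have hw := H.weight_pos x
  have hk := H.pos
  have e1 : (w x ^ (1 + β / 2)) ^ 2 = w x ^ 2 * w x ^ β := by
    rw [← Real.rpow_natCast, ← Real.rpow_mul hw.le, ← Real.rpow_natCast (w x) 2,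
      ← Real.rpow_add hw]
    congr 1
    push_cast
    ring
  have e2 := Real.rpow_pos_of_pos hw β
  rw [div_pow, e1, Real.rpow_neg hw.le]
  field_simp

theorem integrable_quot_sq {β : ℝ} (hβ : 0 ≤ β) (f : L2) :
    Integrable fun x => (f x / w x ^ (1 + β / 2)) ^ 2 := by
  simp_rw [H.quot_sq_eq β]
  exact (H.integrable_rpow_mul_quot_sq hβ f f).const_mul _

theorem integral_quot_sq (β : ℝ) (f : L2) :
    ∫ x, (f x / w x ^ (1 + β / 2)) ^ 2
      = (2 / k) ^ 2 * ∫ x, w x ^ (-β) * (k / (2 * w x)) ^ 2 * (f x * f x) := by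
  simp_rw [H.quot_sq_eq β]
  rw [integral_const_mul]

theorem aestronglyMeasurable_quot (β : ℝ) (f : L2) :
    AEStronglyMeasurable (fun x => f x / w x ^ (1 + β / 2)) volume :=
  ((Lp.aestronglyMeasurable f).aemeasurable.div
    (H.continuous_weight.measurable.pow_const _).aemeasurable).aestronglyMeasurable

/-- Hölder between f²/w^(2+β) and f²: θ = 2β/(2+β) is the exponent with (2+β)θ = 2β, producing the
weight w^(-2β). -/
theorem integral_rpow_mul_sq_le {β : ℝ} (hβ : 0 ≤ β) (hβ1 : β < 1) (f : L2) :
    ∫ x, (w x ^ (-β) * f x) ^ 2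
      ≤ (∫ x, (f x / w x ^ (1 + β / 2)) ^ 2) ^ (2 * β / (2 + β))
        * (‖f‖ ^ 2) ^ ((2 - β) / (2 + β)) := by
  have h0 : 0 ≤ 2 * β / (2 + β) := by positivity
  have e0 : (2 - β) / (2 + β) = 1 - 2 * β / (2 + β) := by field_simp; ring
  have h1 : 0 ≤ 1 - 2 * β / (2 + β) := by
    rw [← e0]
    exact div_nonneg (by linarith) (by linarith)
  have h := integral_rpow_mul_rpow_le (fun x => sq_nonneg (f x / w x ^ (1 + β / 2)))
    (fun x => sq_nonneg (f x)) (H.integrable_quot_sq hβ f) (Lp.memLp f).integrable_sq h0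
    (by linarith)
  rw [e0, L2.norm_sq_eq_integral]
  refine (integral_congr_ae (Eventually.of_forall fun x => ?_)).trans_le h
  have hw := H.weight_pos x
  have hs := sq_nonneg (f x)
  rw [div_pow, Real.div_rpow hs (by positivity), div_mul_eq_mul_div,
    ← Real.rpow_add_of_nonneg hs h0 h1, add_sub_cancel, Real.rpow_one, mul_pow,
    ← Real.rpow_natCast (w x ^ (1 + β / 2)), ← Real.rpow_mul hw.le, ← Real.rpow_mul hw.le,
    ← Real.rpow_natCast (w x ^ (-β)), ← Real.rpow_mul hw.le, div_eq_mul_inv, ← Real.rpow_neg hw.le,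
    mul_comm]
  congr 2
  push_cast
  field_simp

theorem rellich_bounds {β : ℝ} (hβ : 0 ≤ β) (hβ1 : β < 1) {f g h : L2} (hg : IsWeakDeriv f g)
    (hh : IsWeakDeriv g h) :
    √(∫ x, (f x / w x ^ (1 + β / 2)) ^ 2)
        ≤ (4 / ((1 - β ^ 2) * k ^ 2)) ^ ((2 + β) / 4) * ‖mulOp V f - h‖ ^ ((2 + β) / 4)
          * ‖f‖ ^ ((2 - β) / 4) ∧
      ∫ x, (mulOp V f - h : L2) x * (w x ^ (-β) * f x)
        ≤ (4 / ((1 - β ^ 2) * k ^ 2)) ^ (β / 2) * ‖mulOp V f - h‖ ^ (1 + β / 2)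
          * ‖f‖ ^ (1 - β / 2) := by
  have hk := H.pos
  have hβ2 : 0 < 1 - β ^ 2 := by nlinarith
  set P := ∫ x, (f x / w x ^ (1 + β / 2)) ^ 2 with hP
  have hP0 : 0 ≤ P := integral_nonneg fun x => sq_nonneg _
  refine interpolation_bounds (Real.sqrt_nonneg _) (by positivity) (norm_nonneg _) (norm_nonneg _)
    hβ hβ1 ?_ ?_
  · rw [Real.sq_sqrt hP0, hP, H.integral_quot_sq]
    have h1 := H.rellich_form hβ hg hh
    rw [mul_comm, ← le_div_iff₀ hβ2] at h1
    refine (mul_le_mul_of_nonneg_left h1 (by positivity)).trans_eq ?_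
    rw [← div_div]
    ring
  · have hm := H.memLp_rpow_mul hβ f
    have e1 : ∫ x, (mulOp V f - h : L2) x * (w x ^ (-β) * f x)
        = ⟪mulOp V f - h, hm.toLp _⟫_ℝ := by
      rw [L2.inner_eq_integral]
      apply integral_congr_ae
      filter_upwards [hm.coeFn_toLp] with x hx
      rw [hx]
    have e2 : ‖hm.toLp _‖ ^ 2 = ∫ x, (w x ^ (-β) * f x) ^ 2 := by
      rw [L2.norm_sq_eq_integral]
      apply integral_congr_ae
      filter_upwards [hm.coeFn_toLp] with x hx
      rw [hx]
    rw [e1]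
    refine (real_inner_le_norm _ _).trans (mul_le_mul_of_nonneg_left ?_ (norm_nonneg _))
    -- The norm bound is squared to match the Hölder estimate on integrals.
    rw [← pow_le_pow_iff_left₀ (norm_nonneg _) (by positivity) two_ne_zero, e2, mul_pow,
      ← Real.rpow_two, ← Real.rpow_two, ← Real.rpow_mul (Real.sqrt_nonneg _),
      ← Real.rpow_mul (norm_nonneg _), mul_comm _ (2 : ℝ), mul_comm _ (2 : ℝ),
      Real.rpow_mul (Real.sqrt_nonneg _), Real.rpow_mul (norm_nonneg _)]
    simp only [Real.rpow_two]
    rw [Real.sq_sqrt hP0]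
    simpa only [Real.rpow_two] using H.integral_rpow_mul_sq_le hβ hβ1 f

theorem weighted_energy_eq {β : ℝ} (x s t : ℝ) :
    (s ^ 2 + V x * t ^ 2) / w x ^ β
      = w x ^ (-β) * (s * s) + w x ^ (-β) * V x * (t * t) := by
  rw [Real.rpow_neg (H.weight_pos x).le, div_eq_mul_inv]
  ring

end HardyWeight

end SchrodingerLine
-- The three inequalities
open SchrodingerLine
theorem lemma3p1 (V : ℝ →ᵇ ℝ) (hV : V ∈ potentialClass)
    (ψ₁ ψ₂ : ℝ → ℝ) (hψ : IsFundamentalPair V ψ₁ ψ₂)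
    (k : ℝ) (hk : ∀ x, deriv ψ₁ x * ψ₂ x - ψ₁ x * deriv ψ₂ x = k) :
    -- (i)
    (∀ T : L2 →ₗ.[ℝ] L2, IsNonnegSqrt (schrodinger V) T →
      T.domain = H1 ∧
      ∀ f : T.domain,
        eLpNorm (fun x => (f : L2) x / (ψ₁ x * ψ₂ x)) 2 volume
          ≤ ENNReal.ofReal (2 / k * ‖T f‖)) ∧
    -- (ii)
    (∀ β : ℝ, 0 ≤ β → β < 1 → ∀ f : H2,
      eLpNorm (fun x => (f : L2) x / (ψ₁ x * ψ₂ x) ^ (1 + β / 2)) 2 volume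
        ≤ ENNReal.ofReal ((4 / ((1 - β ^ 2) * k ^ 2)) ^ ((2 + β) / 4) *
            ‖schrodinger V f‖ ^ ((2 + β) / 4) * ‖(f : L2)‖ ^ ((2 - β) / 4))) ∧
    -- (iii)
    (∀ β : ℝ, 0 ≤ β → β < 1 → ∀ f : H2,
      Integrable (fun x => ((weakDeriv ⟨f, H2_le_H1 f.2⟩ : L2) x ^ 2 + V x * (f : L2) x ^ 2) /
        (ψ₁ x * ψ₂ x) ^ β) ∧
      ∫ x, ((weakDeriv ⟨f, H2_le_H1 f.2⟩ : L2) x ^ 2 + V x * (f : L2) x ^ 2) /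
          (ψ₁ x * ψ₂ x) ^ β
        ≤ (1 + β) / (1 - β) * (4 / ((1 - β ^ 2) * k ^ 2)) ^ (β / 2) *
            ‖schrodinger V f‖ ^ (1 + β / 2) * ‖(f : L2)‖ ^ (1 - β / 2)) := by

  have H := hψ.hardyWeight hV hk
  have hk0 := H.pos
  refine ⟨fun T hT => ⟨hT.domain_eq_H1 hV.1, fun f => ?_⟩, fun β hβ hβ1 f => ?_,
    fun β hβ hβ1 f => ?_⟩
  · obtain ⟨g, hg⟩ := mem_H1.1 ((hT.domain_eq_H1 hV.1).le f.2)
    -- Assertion (i) is the case β = 0 of the weight w^(1+β/2).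
    have hm := H.aestronglyMeasurable_quot 0 (f : L2)
    have hi := H.integrable_quot_sq le_rfl (f : L2)
    have he := H.integral_quot_sq 0 (f : L2)
    have hb := H.hardy hg
    simp only [zero_div, add_zero, Real.rpow_one, neg_zero, Real.rpow_zero, one_mul] at hm hi he
    refine eLpNorm_two_le_ofReal hm hi (by positivity) ?_
    rw [he, mul_pow, hT.norm_sq_eq hV.1 f hg]
    exact mul_le_mul_of_nonneg_left hb (by positivity)
  · obtain ⟨g, h, hg, hh⟩ := mem_H2.1 f.2
    have hb := (H.rellich_bounds hβ hβ1 hg hh).1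
    rw [← schrodinger_eq_of_isWeakDeriv V f hg hh] at hb
    exact eLpNorm_two_le_ofReal (H.aestronglyMeasurable_quot β (f : L2))
      (H.integrable_quot_sq hβ (f : L2)) ((Real.sqrt_nonneg _).trans hb)
      ((Real.sqrt_le_left ((Real.sqrt_nonneg _).trans hb)).1 hb)
  · obtain ⟨g, h, hg, hh⟩ := mem_H2.1 f.2
    have hb := (H.rellich_bounds hβ hβ1 hg hh).2
    have hE := H.energy_le hβ hβ1 hg hh
    rw [weakDeriv_eq_of_isWeakDeriv ⟨f, H2_le_H1 f.2⟩ hg]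
    simp_rw [H.weighted_energy_eq]
    have i1 := H.integrable_rpow hβ g g
    have i2 := H.integrable_rpow_mul hβ V.continuous V.norm_coe_le_norm (f : L2) f
    refine ⟨i1.add i2, ?_⟩
    rw [integral_add i1 i2, schrodinger_eq_of_isWeakDeriv V f hg hh]
    refine hE.trans ((mul_le_mul_of_nonneg_left hb
      (div_nonneg (by linarith) (by linarith))).trans_eq (by ring))
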